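/- Fix $\mathbf K\in\{\mathbf R,\mathbf C\}$. All spaces are Hausdorff locally convex spaces over $\mathbf K$. A map $\tilde f=(E,F,f)$ consists of two such spaces and a function $f$ from a subset $\operatorname{dom} f$ of $E$ to $F$. For $u\in E$ let $$d_uf(x)=\lim_{t\to0}t^{-1}\bigl(f(x+tu)-f(x)\bigr),$$ where $t$ runs through the $t\in\mathbf K\setminus\{0\}$ with $x+tu\in\operatorname{dom} f$; it is defined exactly when $x\in\operatorname{dom} f$, $0$ is a limit point of the set of these $t$, and the limit exists in $F$. Put $\delta f(x,u)=d_uf(x)$ and $\delta^kf(x,u_1,\dots,u_k)=d_{u_k}(\cdots(d_{u_1}f))(x)$, each wherever defined; this gives maps $\delta\tilde f=(E\times E,F,\delta f)$ and $\delta^k\tilde f=(E^{k+1},F,\delta^kf)$. Let $d^kf(x)$ be the function $(u_1,\dots,u_k)\mapsto\delta^kf(x,u_1,\dots,u_k)$, with domain the set of those $x$ for which it is defined on all of $E^k$ and multilinear. The map $\tilde f$ is *almost Gateaux differentiable* if $\operatorname{dom}\delta f=\operatorname{dom} f\times E$. For $\tilde f=(E,F,f)$ and $\tilde g=(F,G,g)$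 let $\tilde g\circ\tilde f=(E,G,g\circ f)$, where $\operatorname{dom}(g\circ f)=\{x\in\operatorname{dom} f: f(x)\in\operatorname{dom} g\}$. For $k\in\{0,1,2,\dots,\infty\}$ let $C^k_\Pi$ be the class of the maps $(E,F,f)$ such that $\operatorname{dom} f$ is open in $E$ and, for every natural number $l\le k$: $\operatorname{dom} d^lf=\operatorname{dom} f$; each $d^lf(x)$ is a continuous multilinear map $E^l\to F$; and for all $x\in\operatorname{dom} f$ and all zero neighbourhoods $W$ of $F$ there is a zero neighbourhood $U$ of $E$ such that for every $\varepsilon>0$ there is a zero neighbourhood $V$ of $E$ such that, for all $v\in V$, $\;(d^lf(x+v)-d^lf(x))[U^l]\subseteq\varepsilon W$. (So $C^0_\Pi$ is the class of the continuous maps with open domain.) Let $C^\infty_c$ be the class of the maps $\tilde f\in C^0_\Pi$ with $\operatorname{dom} d^if=\operatorname{dom} f$ and $\delta^i\tilde f\in C^0_\Pi$ for all natural numbers $i$. **Theorem 3.5.** Let $\mathcal C\subseteq C^0_\Pi$ be a class of maps such that every $\tilde f\in\mathcal C$ is almost Gateaux differentiable and has some $\tilde g\in\mathcal C$ and some $\tilde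 h\in C^\infty_c$ with $\delta\tilde f=\tilde g\circ\tilde h$. Then $\mathcal C\subseteq C^\infty_\Pi$. -/

import Mathlib

open Filter Topology
open scoped Pointwise

universe w u v

namespace Keller

/-- A Hausdorff locally convex space over `𝕜`, where `𝕜` is `ℝ` or `ℂ`. Local convexity is expressed
by Mathlib's `PolynormableSpace`: the topology is generated by a family of seminorms. -/
structure LCS (𝕜 : Type w) [RCLike 𝕜] : Type (max w (u + 1)) where
  carrier : Type u
  [addCommGroup : AddCommGroup carrier]
  [module : Module 𝕜 carrier]
  [topologicalSpace : TopologicalSpace carrier]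
  [isTopologicalAddGroup : IsTopologicalAddGroup carrier]
  [continuousSMul : ContinuousSMul 𝕜 carrier]
  [polynormableSpace : PolynormableSpace 𝕜 carrier]
  [t2Space : T2Space carrier]

attribute [instance] LCS.addCommGroup LCS.module LCS.topologicalSpace LCS.isTopologicalAddGroup
  LCS.continuousSMul LCS.polynormableSpace LCS.t2Space

instance (𝕜 : Type w) [RCLike 𝕜] : CoeSort (LCS.{w, u} 𝕜) (Type u) := ⟨LCS.carrier⟩

section Calculus

/- Functions `f ⊆ E × F`, with a domain that need not be all of `E`, are partial functions
`f : E →. F`. The set of points where `f` is defined is `f.Dom`, and `y ∈ f x` says that `f` is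
defined at `x` with value `y`. -/

variable (𝕜 : Type w) [RCLike 𝕜]
variable {E : Type u} [AddCommGroup E] [Module 𝕜 E] [TopologicalSpace E]
variable {F : Type v} [AddCommGroup F] [Module 𝕜 F] [TopologicalSpace F]

open Classical in
/-- The value of a partial function at a point of its domain (and `0` at other points). -/
noncomputable def value (f : E →. F) (x : E) : F :=
  if h : x ∈ f.Dom then f.fn x h else 0

/-- `y` is the limit of `t⁻¹ (f (x + t u) - f x)` as `t → 0` in `𝕜`, where `t` runs through the
scalars `t ≠ 0` with `x + t u ∈ dom f`. It is required that `x ∈ dom f` and that `0` is a limit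
point of the set of these scalars. -/
def HasDirDeriv (f : E →. F) (u x : E) (y : F) : Prop :=
  x ∈ f.Dom ∧ (𝓝[{t : 𝕜 | t ≠ 0 ∧ x + t • u ∈ f.Dom}] 0).NeBot ∧
    Tendsto (fun t : 𝕜 => t⁻¹ • (value f (x + t • u) - value f x))
      (𝓝[{t : 𝕜 | t ≠ 0 ∧ x + t • u ∈ f.Dom}] 0) (𝓝 y)

/-- The directional derivative `d_u f`, defined at the points where the limit exists. -/
noncomputable def dirDeriv (u : E) (f : E →. F) : E →. F :=
  fun x => ⟨∃ y, HasDirDeriv 𝕜 f u x y, fun h => h.choose⟩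

/-- The iterated directional derivative `d(u₁, …, u_k) f = d_{u_k} (⋯ (d_{u₁} f))`. -/
noncomputable def iterDirDeriv (f : E →. F) : (k : ℕ) → (Fin k → E) → (E →. F)
  | 0, _ => f
  | k + 1, u => dirDeriv 𝕜 (u (Fin.last k)) (iterDirDeriv f k (Fin.init u))

/-- The first variation `δf : (x, u) ↦ d_u f (x)`, from `E × E` to `F`. -/
noncomputable def firstVariation (f : E →. F) : E × E →. F :=
  fun p => dirDeriv 𝕜 p.2 f p.1

/-- The `k`th variation `δ^k f : (x, u₁, …, u_k) ↦ d(u₁, …, u_k) f (x)`, from `E^{k+1}` to `F`. -/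
noncomputable def variation (k : ℕ) (f : E →. F) : (Fin (k + 1) → E) →. F :=
  fun z => iterDirDeriv 𝕜 f k (Fin.tail z) (z 0)

/-- The `k`th differential `d^k f`. It is defined at `x` if `d(u₁, …, u_k) f (x)` exists for all
`u₁, …, u_k ∈ E` and is multilinear in `(u₁, …, u_k)`; its value is this multilinear map. -/
noncomputable def differential (k : ℕ) (f : E →. F) :
    E →. MultilinearMap 𝕜 (fun _ : Fin k => E) F :=
  fun x => ⟨∃ M : MultilinearMap 𝕜 (fun _ : Fin k => E) F, ∀ u, M u ∈ iterDirDeriv 𝕜 f k u x,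
    fun h => h.choose⟩

/-- Almost Gateaux differentiable: `d_u f (x)` exists for all `x ∈ dom f` and all `u ∈ E`. -/
def AlmostGateauxDifferentiable (f : E →. F) : Prop :=
  (firstVariation 𝕜 f).Dom = f.Dom ×ˢ Set.univ

/-- The Keller class `C^k_Π`, for `k ∈ {0, 1, 2, …, ∞}`: the domain of `f` is open, and for each
natural number `l ≤ k` the differential `d^l f` is defined on all of `dom f`, its values are
continuous multilinear maps, and for all `x ∈ dom f` and `W ∈ 𝓝 0` in `F` there is `U ∈ 𝓝 0` in `E`
such that for every `ε > 0` there is `V ∈ 𝓝 0` in `E` such that, for all `v ∈ V`, the map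
`d^l f (x + v) - d^l f (x)` takes `U^l` into `ε W`. -/
def IsCPi (k : ℕ∞) (f : E →. F) : Prop :=
  IsOpen f.Dom ∧ ∀ l : ℕ, (l : ℕ∞) ≤ k →
    (differential 𝕜 l f).Dom = f.Dom ∧
    (∀ x, ∀ M ∈ differential 𝕜 l f x, Continuous M) ∧
    ∀ x ∈ f.Dom, ∀ W ∈ 𝓝 (0 : F), ∃ U ∈ 𝓝 (0 : E), ∀ ε : ℝ, 0 < ε → ∃ V ∈ 𝓝 (0 : E), ∀ v ∈ V,
      ∃ M ∈ differential 𝕜 l f (x + v), ∃ N ∈ differential 𝕜 l f x,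
        ∀ u : Fin l → E, (∀ j, u j ∈ U) → M u - N u ∈ (ε : 𝕜) • W

/-- The Keller class `C^k_c`, for `k ∈ {0, 1, 2, …, ∞}`: `f` is in `C^0_Π`, and for each natural
number `i ≤ k` the differential `d^i f` is defined on all of `dom f` and the variation `δ^i f` is in
`C^0_Π`. -/
def IsCc (k : ℕ∞) (f : E →. F) : Prop :=
  IsCPi 𝕜 0 f ∧ ∀ i : ℕ, (i : ℕ∞) ≤ k →
    (differential 𝕜 i f).Dom = f.Dom ∧ IsCPi 𝕜 0 (variation 𝕜 i f)

end Calculus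

end Keller

/-! The proof passes through a third notion of smoothness, `ContVarOn`, built from first variations
alone: a map has order k + 1 if it is continuous and its first variation has order k. The chain rule
(`HasDerivAlong.comp`) makes each order stable under composition (`ContVarOn.comp`). So if all of 𝒞
has order k, then δf = g ∘ h has order k, and f has order k + 1.

Two comparisons remain. `IsCc.contVarOn` gives h every order. The variations δ^k h differentiate in
x only, while iterated first variations also differentiate in the directions; linearity in the
direction bridges this gap (`ContParamDerivOn.uncurry_linear`). `ContVarOn.isCPi` leads back to
C^∞_Π: increments of d^l f are bounded by values of d^{l+1} f along a segment, and continuity of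
δ^{l+1} f at (x, 0, …, 0) with homogeneity gives one U serving all ε.

Additivity of the first variation and the chain rule both rest on strict differentiability
(`tendsto_slope_of_continuousOn`), which follows from a mean value inequality for seminorms, hence
from Hahn–Banach. -/

namespace Keller

open Set

/-! ### Mean value inequality for seminorms -/

section MeanValue

variable {𝕜 : Type*} [RCLike 𝕜] {F : Type*} [AddCommGroup F] [Module 𝕜 F]

/-- Hahn–Banach: extend c • w ↦ c * p w from the line through w. This reduces the mean value
inequality to a real-valued function. -/
theorem exists_dual_norm_le_seminorm (p : Seminorm 𝕜 F) (w : F) :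
    ∃ g : Module.Dual 𝕜 F, g w = (p w : 𝕜) ∧ ∀ x, ‖g x‖ ≤ p x := by
  by_cases hw : w = 0
  · exact ⟨0, by simp [hw], fun x => by simp⟩
  let f := LinearPMap.mkSpanSingleton (σ := RingHom.id 𝕜) w (p w : 𝕜) hw
  obtain ⟨g, hg, hle⟩ := Module.Dual.exists_extension_of_le_seminorm f.domain f.toFun (p := p) (by
    rintro ⟨x, hx⟩
    obtain ⟨c, rfl⟩ := Submodule.mem_span_singleton.1 hx
    change ‖f _‖ ≤ _
    simp only [f]
    erw [LinearPMap.mkSpanSingleton'_apply]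
    simp [map_smul_eq_mul, abs_of_nonneg (apply_nonneg p w)])
  refine ⟨g, ?_, hle⟩
  have hm : w ∈ f.domain := Submodule.mem_span_singleton_self w
  have h2 : f ⟨w, hm⟩ = (p w : 𝕜) := by
    have h1 : (1 : 𝕜) • w ∈ f.domain := by rwa [one_smul]
    have h3 : f ⟨(1 : 𝕜) • w, h1⟩ = (p w : 𝕜) := by
      simp only [f]
      rw [LinearPMap.mkSpanSingleton'_apply]
      simp
    rw [← h3]
    congr 2
    rw [one_smul]
  exact (hg ⟨w, hm⟩).trans h2

variable [TopologicalSpace F]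

/-- Mean value inequality for a curve in a topological vector space and a continuous seminorm. -/
theorem exists_seminorm_sub_le (p : Seminorm 𝕜 F) (hp : Continuous p) [IsTopologicalAddGroup F]
    {γ γ' : ℝ → F}
    (hγ : ∀ s ∈ Icc (0 : ℝ) 1, Tendsto (fun r : ℝ => (r : 𝕜)⁻¹ • (γ (s + r) - γ s))
      (𝓝[≠] 0) (𝓝 (γ' s))) (y : F) :
    ∃ s ∈ Ioo (0 : ℝ) 1, p (γ 1 - γ 0 - y) ≤ p (γ' s - y) := by
  obtain ⟨g, hg, hle⟩ := exists_dual_norm_le_seminorm p (γ 1 - γ 0 - y)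
  have hd : ∀ s ∈ Icc (0 : ℝ) 1,
      HasDerivAt (fun s => RCLike.re (g (γ s))) (RCLike.re (g (γ' s))) s := by
    intro s hs
    rw [hasDerivAt_iff_tendsto_slope_zero, tendsto_iff_norm_sub_tendsto_zero]
    have h1 : Tendsto (fun r : ℝ => p ((r : 𝕜)⁻¹ • (γ (s + r) - γ s) - γ' s))
        (𝓝[≠] 0) (𝓝 0) := by
      simpa [Function.comp_def] using (hp.tendsto _).comp ((hγ s hs).sub_const (γ' s))
    refine squeeze_zero (fun _ => norm_nonneg _) (fun r => ?_) h1
    refine le_trans ?_ (hle _)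
    refine le_trans (le_of_eq ?_) (RCLike.abs_re_le_norm _)
    rw [Real.norm_eq_abs]
    congr 1
    simp only [map_sub, map_smul, smul_eq_mul, ← RCLike.ofReal_inv, RCLike.re_ofReal_mul]
  obtain ⟨s, hs, h⟩ := exists_hasDerivAt_eq_slope _ _ zero_lt_one
    (fun s hs => (hd s hs).continuousAt.continuousWithinAt)
    (fun s hs => hd s (Ioo_subset_Icc_self hs))
  refine ⟨s, hs, ?_⟩
  have h3 : p (γ 1 - γ 0 - y) = RCLike.re (g (γ' s - y)) := by
    have h4 := congrArg RCLike.re hg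
    rw [RCLike.ofReal_re] at h4
    rw [← h4]
    simp only [map_sub]
    rw [h]
    simp
  rw [h3]
  exact (RCLike.re_le_norm _).trans (hle _)

end MeanValue

/-! ### Directional derivatives, strict differentiability, chain rule -/

section LineDerivative

variable {𝕜 : Type*} [RCLike 𝕜] {E : Type*} [AddCommGroup E] [Module 𝕜 E]
  {F : Type*} [AddCommGroup F] [Module 𝕜 F] [TopologicalSpace F]

variable (𝕜) in
/-- `y` is the derivative of the total function `φ` at `x` in the direction `u`. -/
def HasDerivAlong (φ : E → F) (u x : E) (y : F) : Prop :=
  Tendsto (fun t : 𝕜 => t⁻¹ • (φ (x + t • u) - φ x)) (𝓝[≠] 0) (𝓝 y)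

theorem HasDerivAlong.unique [T2Space F] {φ : E → F} {u x : E} {y z : F}
    (h₁ : HasDerivAlong 𝕜 φ u x y) (h₂ : HasDerivAlong 𝕜 φ u x z) : y = z :=
  tendsto_nhds_unique h₁ h₂

theorem HasDerivAlong.add [ContinuousAdd F] {φ ψ : E → F} {u x : E} {y z : F}
    (h₁ : HasDerivAlong 𝕜 φ u x y) (h₂ : HasDerivAlong 𝕜 ψ u x z) :
    HasDerivAlong 𝕜 (fun x => φ x + ψ x) u x (y + z) := by
  refine (Tendsto.add h₁ h₂).congr fun t => ?_
  rw [← smul_add, add_sub_add_comm]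

theorem HasDerivAlong.const_smul [ContinuousConstSMul 𝕜 F] {φ : E → F} {u x : E} {y : F}
    (c : 𝕜) (h : HasDerivAlong 𝕜 φ u x y) :
    HasDerivAlong 𝕜 (fun x => c • φ x) u x (c • y) := by
  refine (Tendsto.const_smul h c).congr fun t => ?_
  rw [← smul_sub, smul_comm]

theorem HasDerivAlong.prodMk {G : Type*} [AddCommGroup G] [Module 𝕜 G] [TopologicalSpace G]
    {φ : E → F} {ψ : E → G} {u x : E} {y : F} {z : G}
    (h₁ : HasDerivAlong 𝕜 φ u x y) (h₂ : HasDerivAlong 𝕜 ψ u x z) :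
    HasDerivAlong 𝕜 (fun x => (φ x, ψ x)) u x (y, z) :=
  Tendsto.prodMk_nhds h₁ h₂

theorem HasDerivAlong.comp_linear {E' : Type*} [AddCommGroup E'] [Module 𝕜 E']
    {φ : E → F} {L : E' →ₗ[𝕜] E} {u x : E'} {y : F} (h : HasDerivAlong 𝕜 φ (L u) (L x) y) :
    HasDerivAlong 𝕜 (fun x => φ (L x)) u x y := by
  unfold HasDerivAlong at h ⊢
  simpa only [map_add, map_smul] using h

theorem HasDerivAlong.smul_direction [ContinuousConstSMul 𝕜 F] {φ : E → F} {u x : E} {y : F}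
    (h : HasDerivAlong 𝕜 φ u x y) (c : 𝕜) : HasDerivAlong 𝕜 φ (c • u) x (c • y) := by
  rcases eq_or_ne c 0 with rfl | hc
  · simp [HasDerivAlong, tendsto_const_nhds]
  have h1 : Tendsto (fun t : 𝕜 => t * c) (𝓝[≠] 0) (𝓝[≠] 0) := by
    refine tendsto_nhdsWithin_iff.2 ⟨?_, ?_⟩
    · exact tendsto_nhdsWithin_of_tendsto_nhds (by simpa using (continuous_mul_const c).tendsto 0)
    · filter_upwards [self_mem_nhdsWithin] with t ht
      exact mul_ne_zero ht hc
  refine ((Tendsto.comp h h1).const_smul c).congr fun t => ?_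
  simp only [Function.comp, smul_smul]
  congr 1
  field_simp

/-- The mean value inequality along a segment. -/
theorem exists_seminorm_segment_le [IsTopologicalAddGroup F] (p : Seminorm 𝕜 F)
    (hp : Continuous p) {φ : E → F} {x v : E} {φ' : E → F} (hφ : ∀ s ∈ Icc (0 : ℝ) 1, HasDerivAlong 𝕜 φ v (x + (s : 𝕜) • v)
      (φ' (x + (s : 𝕜) • v))) (y : F) :
    ∃ s ∈ Ioo (0 : ℝ) 1, p (φ (x + v) - φ x - y) ≤ p (φ' (x + (s : 𝕜) • v) - y) := by
  have := exists_seminorm_sub_le p hp (γ := fun s => φ (x + (s : 𝕜) • v))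
    (γ' := fun s => φ' (x + (s : 𝕜) • v)) (fun s hs => ?_) y
  · simpa using this
  have h1 : Tendsto (fun r : ℝ => (r : 𝕜)) (𝓝[≠] 0) (𝓝[≠] 0) := by
    refine tendsto_nhdsWithin_iff.2 ⟨?_, ?_⟩
    · exact tendsto_nhdsWithin_of_tendsto_nhds
        (by simpa using (RCLike.continuous_ofReal (K := 𝕜)).tendsto 0)
    · filter_upwards [self_mem_nhdsWithin] with t ht
      simpa using ht
  refine (Tendsto.comp (hφ s hs) h1).congr fun r => ?_
  simp [add_smul, add_assoc]

theorem map_smul_direction [T2Space F] [ContinuousConstSMul 𝕜 F] {Ω : Set E}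
    {φ : E → F} {φ' : E × E → F} (hφ : ∀ x ∈ Ω, ∀ u, HasDerivAlong 𝕜 φ u x (φ' (x, u)))
    {x : E} (hx : x ∈ Ω) (c : 𝕜) (u : E) : φ' (x, c • u) = c • φ' (x, u) :=
  (hφ x hx (c • u)).unique ((hφ x hx u).smul_direction c)

variable [TopologicalSpace E]

theorem HasDerivAlong.congr_of_eqOn [ContinuousAdd E] [ContinuousSMul 𝕜 E] {φ ψ : E → F} {u x : E}
    {y : F} {Ω : Set E} (hΩ : IsOpen Ω) (hx : x ∈ Ω) (h : HasDerivAlong 𝕜 φ u x y)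
    (heq : EqOn φ ψ Ω) : HasDerivAlong 𝕜 ψ u x y := by
  have hc : Continuous fun t : 𝕜 => x + t • u := by fun_prop
  have hev : ∀ᶠ t : 𝕜 in 𝓝[≠] 0, x + t • u ∈ Ω :=
    nhdsWithin_le_nhds (hc.continuousAt.preimage_mem_nhds (hΩ.mem_nhds (by simpa using hx)))
  refine Tendsto.congr' ?_ h
  filter_upwards [hev] with t ht
  rw [heq ht, heq hx]

/-- On an open domain all small t are admissible, so the restricted filter is the punctured
neighbourhood filter and the limit point condition is automatic. -/
theorem hasDirDeriv_iff [ContinuousAdd E] [ContinuousSMul 𝕜 E] {f : E →. F} (hf : IsOpen f.Dom)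
    {u x : E} {y : F} :
    HasDirDeriv 𝕜 f u x y ↔ x ∈ f.Dom ∧ HasDerivAlong 𝕜 (value f) u x y := by
  refine and_congr_right fun hx => ?_
  have hc : Continuous fun t : 𝕜 => x + t • u := by fun_prop
  have hev : {t : 𝕜 | x + t • u ∈ f.Dom} ∈ 𝓝 (0 : 𝕜) :=
    hc.continuousAt.preimage_mem_nhds (hf.mem_nhds (by simpa using hx))
  have h1 : 𝓝[{t : 𝕜 | t ≠ 0 ∧ x + t • u ∈ f.Dom}] 0 = 𝓝[≠] 0 :=
    nhdsWithin_inter_of_mem' (nhdsWithin_le_nhds hev)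
  rw [h1]
  exact ⟨fun h => h.2, fun h => ⟨inferInstance, h⟩⟩

variable [IsTopologicalAddGroup E] [ContinuousSMul 𝕜 E]
  [IsTopologicalAddGroup F] [ContinuousSMul 𝕜 F]

/-- Strict differentiability of a function with jointly continuous directional derivatives. -/
theorem tendsto_slope_of_continuousOn [PolynormableSpace 𝕜 F] {Ω : Set E} (hΩ : IsOpen Ω)
    {φ : E → F} {φ' : E × E → F} (hφ : ∀ x ∈ Ω, ∀ u, HasDerivAlong 𝕜 φ u x (φ' (x, u)))
    (hφ' : ContinuousOn φ' (Ω ×ˢ univ)) {x : E} (hx : x ∈ Ω) (w : E) :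
    Tendsto (fun q : 𝕜 × E × E => q.1⁻¹ • (φ (q.2.1 + q.1 • q.2.2) - φ q.2.1))
      (𝓝[≠] 0 ×ˢ 𝓝 (x, w)) (𝓝 (φ' (x, w))) := by
  rw [(PolynormableSpace.withSeminorms 𝕜 F).tendsto_nhds]
  rintro ⟨p, hp⟩ ε hε
  have hxw : (x, w) ∈ Ω ×ˢ (univ : Set E) := ⟨hx, trivial⟩
  have hopen : IsOpen (Ω ×ˢ (univ : Set E)) := hΩ.prod isOpen_univ
  have hA : {a : E × E | a.1 ∈ Ω ∧ p (φ' a - φ' (x, w)) < ε} ∈ 𝓝 (x, w) := by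
    have h1 : ContinuousAt φ' (x, w) := hφ'.continuousAt (hopen.mem_nhds hxw)
    have h2 := ((PolynormableSpace.withSeminorms 𝕜 F).tendsto_nhds _ _).1 h1 ⟨p, hp⟩ ε hε
    filter_upwards [hopen.mem_nhds hxw, h2] with a ha1 ha2 using ⟨ha1.1, ha2⟩
  have hc : Continuous fun q : 𝕜 × E × E => (q.2.1 + q.1 • q.2.2, q.2.2) := by fun_prop
  have hB := hc.continuousAt.preimage_mem_nhds (x := ((0 : 𝕜), x, w)) (by simpa using hA)
  rw [nhds_prod_eq, mem_prod_iff] at hB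
  obtain ⟨D, hD, B, hB, hDB⟩ := hB
  -- A ball is needed so that s * t stays in D for all s in [0, 1].
  obtain ⟨δ, hδ, hDδ⟩ := Metric.mem_nhds_iff.1 hD
  have h3 : (Metric.ball (0 : 𝕜) δ ∩ {0}ᶜ) ×ˢ B ∈ 𝓝[≠] (0 : 𝕜) ×ˢ 𝓝 (x, w) :=
    prod_mem_prod (inter_mem (nhdsWithin_le_nhds (Metric.ball_mem_nhds _ hδ))
      self_mem_nhdsWithin) hB
  filter_upwards [h3]
  rintro ⟨t, y, z⟩ ⟨⟨ht, ht0⟩, hyz⟩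
  have hmem : ∀ s ∈ Icc (0 : ℝ) 1, y + (s : 𝕜) • t • z ∈ Ω ∧
      p (φ' (y + (s : 𝕜) • t • z, z) - φ' (x, w)) < ε := by
    intro s hs
    have h5 : ((s : 𝕜) * t) ∈ D := by
      refine hDδ ?_
      rw [mem_ball_zero_iff] at ht ⊢
      rw [norm_mul, RCLike.norm_ofReal, abs_of_nonneg hs.1]
      exact (mul_le_of_le_one_left (norm_nonneg _) hs.2).trans_lt ht
    have h6 := hDB (show ((s : 𝕜) * t, y, z) ∈ D ×ˢ B from ⟨h5, hyz⟩)
    simpa [mul_smul] using h6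
  -- The factor t⁻¹ cancels the t in the direction, so the mean value inequality bounds the slope
  -- without any loss in t.
  have hd : ∀ s ∈ Icc (0 : ℝ) 1, HasDerivAlong 𝕜 (fun a => t⁻¹ • φ a) (t • z)
      (y + (s : 𝕜) • t • z) (φ' (y + (s : 𝕜) • t • z, z)) := by
    intro s hs
    have := ((hφ _ (hmem s hs).1 z).smul_direction t).const_smul t⁻¹
    rwa [inv_smul_smul₀ (show t ≠ 0 from ht0)] at this
  obtain ⟨s, hs, hle⟩ := exists_seminorm_segment_le p hp (φ' := fun a => φ' (a, z)) hd (φ' (x, w))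
  rw [← smul_sub] at hle
  exact hle.trans_lt (hmem s (Ioo_subset_Icc_self hs)).2

/-- Split the difference quotient at x + t • u. The second part has a moving base point, which is
where strict differentiability enters. -/
theorem map_add_direction [PolynormableSpace 𝕜 F] [T2Space F] {Ω : Set E} (hΩ : IsOpen Ω)
    {φ : E → F} {φ' : E × E → F} (hφ : ∀ x ∈ Ω, ∀ u, HasDerivAlong 𝕜 φ u x (φ' (x, u)))
    (hφ' : ContinuousOn φ' (Ω ×ˢ univ)) {x : E} (hx : x ∈ Ω) (u v : E) :
    φ' (x, u + v) = φ' (x, u) + φ' (x, v) := by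
  refine (hφ x hx (u + v)).unique (𝕜 := 𝕜) ?_
  have h1 : Tendsto (fun t : 𝕜 => (t, x + t • u, v)) (𝓝[≠] 0) (𝓝[≠] 0 ×ˢ 𝓝 (x, v)) := by
    refine tendsto_id.prodMk (tendsto_nhdsWithin_of_tendsto_nhds ?_)
    have hc : Continuous fun t : 𝕜 => (x + t • u, v) := by fun_prop
    simpa using hc.tendsto 0
  have h2 := (tendsto_slope_of_continuousOn hΩ hφ hφ' hx v).comp h1
  refine (Tendsto.add (hφ x hx u) h2).congr fun t => ?_
  simp only [Function.comp, ← smul_add, add_assoc]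
  congr 1
  abel

/-- The chain rule for directional derivatives. -/
theorem HasDerivAlong.comp [PolynormableSpace 𝕜 F] {Ω : Set E} (hΩ : IsOpen Ω)
    {φ : E → F} {φ' : E × E → F} (hφ : ∀ x ∈ Ω, ∀ u, HasDerivAlong 𝕜 φ u x (φ' (x, u)))
    (hφ' : ContinuousOn φ' (Ω ×ˢ univ)) {D : Type*} [AddCommGroup D] [Module 𝕜 D]
    {ψ : D → E} {u x : D} {y : E} (hψ : HasDerivAlong 𝕜 ψ u x y) (hx : ψ x ∈ Ω) :
    HasDerivAlong 𝕜 (fun a => φ (ψ a)) u x (φ' (ψ x, y)) := by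
  -- The increment of ψ is t times a direction that varies with t and tends to y.
  have h1 : Tendsto (fun t : 𝕜 => (t, ψ x, t⁻¹ • (ψ (x + t • u) - ψ x))) (𝓝[≠] 0)
      (𝓝[≠] 0 ×ˢ 𝓝 (ψ x, y)) :=
    tendsto_id.prodMk (tendsto_const_nhds.prodMk_nhds hψ)
  refine ((tendsto_slope_of_continuousOn hΩ hφ hφ' hx y).comp h1).congr' ?_
  filter_upwards [self_mem_nhdsWithin] with t ht
  have ht : t ≠ 0 := ht
  simp [smul_smul, ht]

end LineDerivative

/-! ### Two recursive notions of smoothness -/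

section Classes

variable (𝕜 : Type w) [RCLike 𝕜]

/-- `φ` is `k` times continuously differentiable on the open set `Ω`, in terms of iterated first
variations. -/
def ContVarOn : ℕ → ∀ {E : Type u} [AddCommGroup E] [Module 𝕜 E] [TopologicalSpace E]
    {F : Type v} [AddCommGroup F] [Module 𝕜 F] [TopologicalSpace F], Set E → (E → F) → Prop
  | 0, _, _, _, _, _, _, _, _, Ω, φ => IsOpen Ω ∧ ContinuousOn φ Ω
  | k + 1, E, _, _, _, F, _, _, _, Ω, φ => IsOpen Ω ∧ ContinuousOn φ Ω ∧ ∃ φ' : E × E → F,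
      (∀ x ∈ Ω, ∀ u, HasDerivAlong 𝕜 φ u x (φ' (x, u))) ∧ ContVarOn k (Ω ×ˢ univ) φ'

/-- `H (x, p)` has `k` iterated directional derivatives in `x ∈ Ω`, continuous jointly in `x`, the
parameter `p`, and the directions. -/
def ContParamDerivOn {E : Type u} [AddCommGroup E] [Module 𝕜 E] [TopologicalSpace E]
    {F : Type v} [AddCommGroup F] [Module 𝕜 F] [TopologicalSpace F] (Ω : Set E) :
    ℕ → ∀ {P : Type u} [TopologicalSpace P], (E × P → F) → Prop
  | 0, _, _, H => ContinuousOn H (Ω ×ˢ univ)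
  | k + 1, P, _, H => ContinuousOn H (Ω ×ˢ univ) ∧ ∃ H' : E × (P × E) → F,
      (∀ x ∈ Ω, ∀ p u, HasDerivAlong 𝕜 (fun x => H (x, p)) u x (H' (x, p, u))) ∧
        ContParamDerivOn Ω k H'

end Classes

variable {𝕜 : Type w} [RCLike 𝕜]

/-! ### Stability of `ContVarOn`, in particular under composition -/

section ContVarOn

variable {E : Type u} [AddCommGroup E] [Module 𝕜 E] [TopologicalSpace E]
variable {F : Type v} [AddCommGroup F] [Module 𝕜 F] [TopologicalSpace F]

theorem ContVarOn.isOpen {k : ℕ} {Ω : Set E} {φ : E → F} (h : ContVarOn 𝕜 k Ω φ) : IsOpen Ω := by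
  cases k <;> exact h.1

theorem ContVarOn.continuousOn {k : ℕ} {Ω : Set E} {φ : E → F} (h : ContVarOn 𝕜 k Ω φ) :
    ContinuousOn φ Ω := by
  cases k
  · exact h.2
  · exact h.2.1

theorem ContVarOn.of_succ {k : ℕ} {Ω : Set E} {φ : E → F} (h : ContVarOn 𝕜 (k + 1) Ω φ) :
    ContVarOn 𝕜 k Ω φ := by
  induction k generalizing E with
  | zero => exact ⟨h.1, h.2.1⟩
  | succ k ih =>
    obtain ⟨h1, h2, φ', h3, h4⟩ := h
    exact ⟨h1, h2, φ', h3, ih h4⟩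

theorem ContVarOn.congr [ContinuousAdd E] [ContinuousSMul 𝕜 E] {k : ℕ} {Ω : Set E} {φ ψ : E → F}
    (h : ContVarOn 𝕜 k Ω φ) (heq : EqOn φ ψ Ω) : ContVarOn 𝕜 k Ω ψ := by
  cases k with
  | zero => exact ⟨h.1, h.2.congr heq.symm⟩
  | succ k =>
    obtain ⟨h1, h2, φ', h3, h4⟩ := h
    exact ⟨h1, h2.congr heq.symm, φ', fun x hx u => (h3 x hx u).congr_of_eqOn h1 hx heq, h4⟩

theorem ContVarOn.comp_linear {k : ℕ} {Ω : Set E} {φ : E → F} (h : ContVarOn 𝕜 k Ω φ)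
    {E' : Type u} [AddCommGroup E'] [Module 𝕜 E'] [TopologicalSpace E'] (L : E' →L[𝕜] E) :
    ContVarOn 𝕜 k (L ⁻¹' Ω) (fun x => φ (L x)) := by
  induction k generalizing E E' with
  | zero => exact ⟨h.1.preimage L.continuous, h.2.comp L.continuous.continuousOn fun x hx => hx⟩
  | succ k ih =>
    obtain ⟨h1, h2, φ', h3, h4⟩ := h
    refine ⟨h1.preimage L.continuous, h2.comp L.continuous.continuousOn fun x hx => hx,
      fun z => φ' (L z.1, L z.2), fun x hx u => (h3 (L x) hx (L u)).comp_linear (L := L.toLinearMap),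
      ?_⟩
    have := ih h4 (L.prodMap L)
    convert this using 1
    · ext z
      simp
    · rfl

theorem ContVarOn.prodMk {k : ℕ} {Ω : Set E} {φ : E → F} (h : ContVarOn 𝕜 k Ω φ)
    {G : Type v} [AddCommGroup G] [Module 𝕜 G] [TopologicalSpace G] {ψ : E → G}
    (h' : ContVarOn 𝕜 k Ω ψ) : ContVarOn 𝕜 k Ω (fun x => (φ x, ψ x)) := by
  induction k generalizing E with
  | zero => exact ⟨h.1, h.2.prodMk h'.2⟩
  | succ k ih =>
    obtain ⟨h1, h2, φ', h3, h4⟩ := h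
    obtain ⟨_, h2', ψ', h3', h4'⟩ := h'
    exact ⟨h1, h2.prodMk h2', fun z => (φ' z, ψ' z), fun x hx u => (h3 x hx u).prodMk (h3' x hx u),
      ih h4 h4'⟩

/-- The first variation of φ ∘ ψ is φ' composed with (x, u) ↦ (ψ x, ψ' (x, u)), again a composite of
maps of order k, so the induction closes. -/
theorem ContVarOn.comp [IsTopologicalAddGroup E] [ContinuousSMul 𝕜 E]
    [IsTopologicalAddGroup F] [ContinuousSMul 𝕜 F] [PolynormableSpace 𝕜 F]
    {k : ℕ} {Ω : Set E} {φ : E → F} (h : ContVarOn 𝕜 k Ω φ)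
    {D : Type u} [AddCommGroup D] [Module 𝕜 D] [TopologicalSpace D] {Θ : Set D} {ψ : D → E}
    (h' : ContVarOn 𝕜 k Θ ψ) : ContVarOn 𝕜 k (Θ ∩ ψ ⁻¹' Ω) (fun x => φ (ψ x)) := by
  induction k generalizing E D with
  | zero =>
    exact ⟨h'.2.isOpen_inter_preimage h'.1 h.1,
      h.2.comp (h'.2.mono inter_subset_left) fun x hx => hx.2⟩
  | succ k ih =>
    have hψ := h'.of_succ.comp_linear (ContinuousLinearMap.fst 𝕜 D D)
    obtain ⟨h1, h2, φ', h3, h4⟩ := h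
    obtain ⟨h1', h2', ψ', h3', h4'⟩ := h'
    refine ⟨h2'.isOpen_inter_preimage h1' h1,
      h2.comp (h2'.mono inter_subset_left) fun x hx => hx.2,
      fun z => φ' (ψ z.1, ψ' z), fun x hx u =>
        (h3' x hx.1 u).comp h1 h3 h4.continuousOn hx.2, ?_⟩
    have hset : ContinuousLinearMap.fst 𝕜 D D ⁻¹' Θ = Θ ×ˢ univ := by
      ext z
      simp
    rw [hset] at hψ
    have := ih h4 (hψ.prodMk h4')
    convert this using 1
    · ext z
      simp
    · rfl

end ContVarOn

/-! ### Derivatives with parameters -/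

section ContParamDerivOn

variable {E : Type u} [AddCommGroup E] [Module 𝕜 E] [TopologicalSpace E]
variable {F : Type v} [AddCommGroup F] [Module 𝕜 F] [TopologicalSpace F]
variable {Ω : Set E} {P : Type u} [TopologicalSpace P]

theorem ContParamDerivOn.continuousOn {k : ℕ} {H : E × P → F} (h : ContParamDerivOn 𝕜 Ω k H) :
    ContinuousOn H (Ω ×ˢ univ) := by
  cases k
  · exact h
  · exact h.1

theorem ContParamDerivOn.of_succ {k : ℕ} {H : E × P → F} (h : ContParamDerivOn 𝕜 Ω (k + 1) H) :
    ContParamDerivOn 𝕜 Ω k H := by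
  induction k generalizing P with
  | zero => exact h.1
  | succ k ih =>
    obtain ⟨h1, H', h2, h3⟩ := h
    exact ⟨h1, H', h2, ih h3⟩

theorem ContParamDerivOn.comp {k : ℕ} {H : E × P → F} (h : ContParamDerivOn 𝕜 Ω k H)
    {E' : Type u} [AddCommGroup E'] [Module 𝕜 E'] [TopologicalSpace E'] (L : E' →L[𝕜] E)
    {P' : Type u} [TopologicalSpace P'] {σ : P' → P} (hσ : Continuous σ) :
    ContParamDerivOn 𝕜 (L ⁻¹' Ω) k (fun z : E' × P' => H (L z.1, σ z.2)) := by
  have hc : ContinuousOn (fun z : E' × P' => H (L z.1, σ z.2)) ((L ⁻¹' Ω) ×ˢ univ) :=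
    h.continuousOn.comp (by fun_prop) fun z hz => ⟨hz.1, trivial⟩
  induction k generalizing P P' with
  | zero => exact hc
  | succ k ih =>
    obtain ⟨h1, H', h2, h3⟩ := h
    refine ⟨hc, fun z => H' (L z.1, σ z.2.1, L z.2.2), fun x hx p u =>
      (h2 (L x) hx (σ p) (L u)).comp_linear (φ := fun x => H (x, σ p)) (L := L.toLinearMap), ?_⟩
    refine ih (σ := fun q : P' × E' => (σ q.1, L q.2)) h3 (by fun_prop) ?_
    exact h3.continuousOn.comp (by fun_prop) fun z hz => ⟨hz.1, trivial⟩

theorem ContParamDerivOn.comp_param {k : ℕ} {H : E × P → F} (h : ContParamDerivOn 𝕜 Ω k H)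
    {P' : Type u} [TopologicalSpace P'] {σ : P' → P} (hσ : Continuous σ) :
    ContParamDerivOn 𝕜 Ω k (fun z : E × P' => H (z.1, σ z.2)) :=
  h.comp (ContinuousLinearMap.id 𝕜 E) hσ

theorem ContParamDerivOn.add [ContinuousAdd F] {k : ℕ} {H K : E × P → F}
    (h : ContParamDerivOn 𝕜 Ω k H) (h' : ContParamDerivOn 𝕜 Ω k K) :
    ContParamDerivOn 𝕜 Ω k (fun z => H z + K z) := by
  induction k generalizing P with
  | zero => exact ContinuousOn.add h h'
  | succ k ih =>
    obtain ⟨h1, H', h2, h3⟩ := h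
    obtain ⟨h1', K', h2', h3'⟩ := h'
    exact ⟨h1.add h1', fun z => H' z + K' z, fun x hx p u => (h2 x hx p u).add (h2' x hx p u),
      ih h3 h3'⟩

/-- A parameter on which the function depends linearly can be made part of the variable. -/
theorem ContParamDerivOn.uncurry_linear [IsTopologicalAddGroup E] [ContinuousSMul 𝕜 E]
    [IsTopologicalAddGroup F] [ContinuousSMul 𝕜 F] [T2Space F] (hΩ : IsOpen Ω)
    {k : ℕ} {H : E × (P × E) → F} (h : ContParamDerivOn 𝕜 Ω k H)
    (hlin : ∀ x ∈ Ω, ∀ p u v, ∀ c : 𝕜, H (x, p, u + c • v) = H (x, p, u) + c • H (x, p, v)) :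
    ContParamDerivOn 𝕜 (Ω ×ˢ (univ : Set E)) k
      (fun z : (E × E) × P => H (z.1.1, z.2, z.1.2)) := by
  have hc : ContinuousOn (fun z : (E × E) × P => H (z.1.1, z.2, z.1.2))
      ((Ω ×ˢ (univ : Set E)) ×ˢ univ) :=
    h.continuousOn.comp (by fun_prop) fun z hz => ⟨hz.1.1, trivial⟩
  induction k generalizing P with
  | zero => exact hc
  | succ k ih =>
    have hH := h.of_succ
    obtain ⟨h1, H', h2, h3⟩ := h
    -- Product rule: along (y, v), differentiate in x along y with u fixed, and replace the linear
    -- argument u by v.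
    refine ⟨hc, fun z => H' (z.1.1, (z.2.1, z.1.2), z.2.2.1) + H (z.1.1, z.2.1, z.2.2.2),
      ?_, ?_⟩
    · rintro ⟨x, u⟩ ⟨hx, -⟩ p ⟨y, v⟩
      have hline : Continuous fun t : 𝕜 => x + t • y := by fun_prop
      have hmem : ∀ᶠ t : 𝕜 in 𝓝[≠] 0, x + t • y ∈ Ω :=
        nhdsWithin_le_nhds (hline.continuousAt.preimage_mem_nhds (hΩ.mem_nhds (by simpa using hx)))
      have hcont : Tendsto (fun t : 𝕜 => H (x + t • y, p, v)) (𝓝[≠] 0) (𝓝 (H (x, p, v))) := by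
        have h5 : ContinuousAt H (x, p, v) :=
          h1.continuousAt ((hΩ.prod isOpen_univ).mem_nhds ⟨hx, trivial⟩)
        have h6 : Continuous fun t : 𝕜 => (x + t • y, p, v) := by fun_prop
        have h7 : Tendsto (fun t : 𝕜 => (x + t • y, p, v)) (𝓝[≠] 0) (𝓝 (x, p, v)) :=
          tendsto_nhdsWithin_of_tendsto_nhds (by simpa using h6.tendsto 0)
        exact h5.tendsto.comp h7
      refine (Tendsto.add (h2 x hx (p, u) y) hcont).congr' ?_
      filter_upwards [hmem, self_mem_nhdsWithin] with t ht ht0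
      have ht0 : t ≠ 0 := ht0
      simp only [Prod.mk_add_mk, Prod.smul_mk]
      rw [hlin _ ht, add_sub_right_comm, smul_add, inv_smul_smul₀ ht0]
    -- Differentiating the linearity identity in x shows that H' is still linear in u; the new
    -- direction joins the parameter.
    · have hlin' : ∀ x ∈ Ω, ∀ (q : P × E) u v, ∀ c : 𝕜,
          H' (x, (q.1, u + c • v), q.2) = H' (x, (q.1, u), q.2) + c • H' (x, (q.1, v), q.2) := by
        intro x hx q u v c
        refine (h2 x hx (q.1, u + c • v) q.2).unique ?_
        exact ((h2 x hx (q.1, u) q.2).add ((h2 x hx (q.1, v) q.2).const_smul c)).congr_of_eqOn hΩ hx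
          fun a ha => (hlin a ha q.1 u v c).symm
      have h4 : ContParamDerivOn 𝕜 Ω k
          (fun z : E × ((P × E) × E) => H' (z.1, (z.2.1.1, z.2.2), z.2.1.2)) :=
        h3.comp_param (σ := fun q : (P × E) × E => ((q.1.1, q.2), q.1.2)) (by fun_prop)
      have h5 := ih h4 hlin' (h4.continuousOn.comp (by fun_prop) fun z hz => ⟨hz.1.1, trivial⟩)
      have h6 := h5.comp_param (σ := fun q : P × (E × E) => (q.1, q.2.1)) (by fun_prop)
      have h7 := hH.comp (ContinuousLinearMap.fst 𝕜 E E)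
        (σ := fun q : P × (E × E) => (q.1, q.2.2)) (by fun_prop)
      have hset : ContinuousLinearMap.fst 𝕜 E E ⁻¹' Ω = Ω ×ˢ univ := by
        ext z
        simp
      rw [hset] at h7
      exact h6.add h7

/-- The derivative carries its direction as a parameter. Being linear there, it can be read as a
function on Ω ×ˢ univ with trivial parameter again, to which induction applies. -/
theorem ContParamDerivOn.contVarOn [IsTopologicalAddGroup E] [ContinuousSMul 𝕜 E]
    [IsTopologicalAddGroup F] [ContinuousSMul 𝕜 F] [T2Space F] [PolynormableSpace 𝕜 F]
    (hΩ : IsOpen Ω) {k : ℕ} {φ : E → F}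
    (h : ContParamDerivOn 𝕜 Ω k (fun z : E × PUnit.{u + 1} => φ z.1)) : ContVarOn 𝕜 k Ω φ := by
  have hc : ContinuousOn φ Ω :=
    h.continuousOn.comp (f := fun x => (x, PUnit.unit)) (by fun_prop) fun x hx => ⟨hx, trivial⟩
  induction k generalizing E with
  | zero => exact ⟨hΩ, hc⟩
  | succ k ih =>
    obtain ⟨h1, H', h2, h3⟩ := h
    have h2' : ∀ x ∈ Ω, ∀ u, HasDerivAlong 𝕜 φ u x (H' (x, PUnit.unit, u)) :=
      fun x hx u => h2 x hx PUnit.unit u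
    have hcont : ContinuousOn (fun z : E × E => H' (z.1, PUnit.unit, z.2)) (Ω ×ˢ univ) :=
      h3.continuousOn.comp (by fun_prop) fun z hz => ⟨hz.1, trivial⟩
    refine ⟨hΩ, hc, fun z => H' (z.1, PUnit.unit, z.2), h2', ?_⟩
    refine ih (hΩ.prod isOpen_univ) (h3.uncurry_linear hΩ ?_) hcont
    intro x hx p u v c
    have h5 := map_add_direction hΩ (φ' := fun z : E × E => H' (z.1, PUnit.unit, z.2)) h2' hcont
      hx u (c • v)
    have h6 := map_smul_direction (φ' := fun z : E × E => H' (z.1, PUnit.unit, z.2)) h2' hx c v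
    exact h5.trans (congrArg _ h6)

end ContParamDerivOn

/-! ### Partial functions and their values -/

section PartialFunctions

variable {E : Type*} {F : Type*}

theorem mem_dom_of_mem {f : E →. F} {x : E} {y : F} (h : y ∈ f x) : x ∈ f.Dom :=
  Part.dom_iff_mem.2 ⟨y, h⟩

variable [AddCommGroup F]

theorem mem_of_dom {f : E →. F} {x : E} (hx : x ∈ f.Dom) : value f x ∈ f x := by
  rw [value, dif_pos hx]
  exact Part.get_mem _

theorem value_eq_of_mem {f : E →. F} {x : E} {y : F} (h : y ∈ f x) : value f x = y :=
  Part.mem_unique (mem_of_dom (Part.dom_iff_mem.2 ⟨y, h⟩)) h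

end PartialFunctions

/-! ### From C^∞_c to `ContVarOn` -/

variable {𝕜 : Type w} [RCLike 𝕜]
variable {E : Type u} [AddCommGroup E] [Module 𝕜 E]
variable {F : Type v} [AddCommGroup F] [Module 𝕜 F] [TopologicalSpace F]

theorem mem_iterDirDeriv_of_mem_differential {f : E →. F} {l : ℕ} {x : E}
    {M : MultilinearMap 𝕜 (fun _ : Fin l => E) F} (h : M ∈ differential 𝕜 l f x) (u : Fin l → E) :
    M u ∈ iterDirDeriv 𝕜 f l u x := by
  obtain ⟨hd, rfl⟩ := h
  exact hd.choose_spec u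

theorem differential_dom_subset {f : E →. F} {l : ℕ} {x : E} (hx : x ∈ (differential 𝕜 l f).Dom)
    (u : Fin l → E) : x ∈ (iterDirDeriv 𝕜 f l u).Dom := by
  obtain ⟨M, hM⟩ := hx
  exact mem_dom_of_mem (hM u)

theorem mem_differential_of_forall_mem {f : E →. F} {l : ℕ} {x : E} [T2Space F]
    {M : MultilinearMap 𝕜 (fun _ : Fin l => E) F} (h : ∀ u, M u ∈ iterDirDeriv 𝕜 f l u x) :
    M ∈ differential 𝕜 l f x := by
  have hd : x ∈ (differential 𝕜 l f).Dom := ⟨M, h⟩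
  refine ⟨hd, MultilinearMap.ext fun u => ?_⟩
  exact Part.mem_unique (hd.choose_spec u) (h u)

theorem iterDirDeriv_dom_subset (f : E →. F) (l : ℕ) (u : Fin l → E) :
    (iterDirDeriv 𝕜 f l u).Dom ⊆ f.Dom := by
  induction l with
  | zero => exact subset_rfl
  | succ l ih =>
    rintro x ⟨y, hy⟩
    exact ih _ hy.1

variable [TopologicalSpace E]

theorem IsCPi.continuousOn [IsTopologicalAddGroup E] [IsTopologicalAddGroup F] {k : ℕ∞}
    {f : E →. F} (h : IsCPi 𝕜 k f) : ContinuousOn (value f) f.Dom := by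
  intro x hx
  refine ContinuousAt.continuousWithinAt ?_
  have h0 := (h.2 0 (by simp)).2.2 x hx
  have key : Tendsto (fun v => value f (x + v) - value f x) (𝓝 0) (𝓝 0) := by
    intro W hW
    obtain ⟨U, -, hU⟩ := h0 W hW
    obtain ⟨V, hV, hVW⟩ := hU 1 one_pos
    rw [mem_map]
    filter_upwards [hV] with v hv
    rw [mem_preimage]
    obtain ⟨M, hM, N, hN, hMN⟩ := hVW v hv
    have h1 := hMN Fin.elim0 (fun j => j.elim0)
    rw [RCLike.ofReal_one, one_smul] at h1
    rwa [← value_eq_of_mem (mem_iterDirDeriv_of_mem_differential hM Fin.elim0),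
      ← value_eq_of_mem (mem_iterDirDeriv_of_mem_differential hN Fin.elim0)] at h1
  have h2 : Tendsto (fun y : E => y - x) (𝓝 x) (𝓝 0) := by
    have h3 : Continuous fun y : E => y - x := by fun_prop
    simpa using h3.tendsto x
  simpa [ContinuousAt, Function.comp_def] using (key.comp h2).add_const (value f x)

theorem hasDerivAlong_iterDirDeriv [ContinuousAdd E] [ContinuousSMul 𝕜 E] [T2Space F]
    {f : E →. F} {l : ℕ} {u : Fin l → E} {v x : E}
    (hopen : IsOpen (iterDirDeriv 𝕜 f l u).Dom)
    (hx : x ∈ (iterDirDeriv 𝕜 f (l + 1) (Fin.snoc u v : Fin (l + 1) → E)).Dom) :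
    HasDerivAlong 𝕜 (value (iterDirDeriv 𝕜 f l u)) v x
      (value (iterDirDeriv 𝕜 f (l + 1) (Fin.snoc u v : Fin (l + 1) → E)) x) := by
  have h1 := mem_of_dom hx
  simp only [iterDirDeriv, Fin.init_snoc, Fin.snoc_last] at h1 ⊢
  obtain ⟨h2, h3⟩ := h1
  rw [← h3]
  exact ((hasDirDeriv_iff hopen).1 h2.choose_spec).2

/-- A map of class `C^∞_c` is infinitely differentiable in terms of iterated first variations. -/
theorem IsCc.contVarOn [IsTopologicalAddGroup E] [ContinuousSMul 𝕜 E]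
    [IsTopologicalAddGroup F] [ContinuousSMul 𝕜 F] [T2Space F] [PolynormableSpace 𝕜 F]
    {f : E →. F} (h : IsCc 𝕜 ⊤ f) (k : ℕ) : ContVarOn 𝕜 k f.Dom (value f) := by
  have hΩ : IsOpen f.Dom := h.1.1
  have hdom : ∀ l (u : Fin l → E), (iterDirDeriv 𝕜 f l u).Dom = f.Dom := fun l u =>
    (iterDirDeriv_dom_subset f l u).antisymm fun x hx =>
      differential_dom_subset (by rw [(h.2 l le_top).1]; exact hx) u
  have hcont : ∀ l, ContinuousOn (fun z : E × (Fin l → E) => value (iterDirDeriv 𝕜 f l z.2) z.1)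
      (f.Dom ×ˢ univ) := by
    intro l
    have h1 := (h.2 l le_top).2.continuousOn
    have h2 : ContinuousOn (fun z : E × (Fin l → E) =>
        value (variation 𝕜 l f) (Fin.cons z.1 z.2 : Fin (l + 1) → E)) (f.Dom ×ˢ univ) := by
      refine h1.comp (f := fun z : E × (Fin l → E) => (Fin.cons z.1 z.2 : Fin (l + 1) → E))
        ?_ fun z hz => ?_
      · exact (continuous_pi fun i => by
          cases i using Fin.cases <;> simp <;> fun_prop : Continuous
            fun z : E × (Fin l → E) => (Fin.cons z.1 z.2 : Fin (l + 1) → E)).continuousOn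
      · change z.1 ∈ (iterDirDeriv 𝕜 f l z.2).Dom
        rw [hdom]
        exact hz.1
    exact h2
  -- The parameter is the tuple of directions; each further derivative in x appends one entry.
  have main : ∀ n l, ContParamDerivOn 𝕜 f.Dom n
      (fun z : E × (Fin l → E) => value (iterDirDeriv 𝕜 f l z.2) z.1) := by
    intro n
    induction n with
    | zero => exact hcont
    | succ n ih =>
      intro l
      refine ⟨hcont l, fun z => value (iterDirDeriv 𝕜 f (l + 1)
        (Fin.snoc z.2.1 z.2.2 : Fin (l + 1) → E)) z.1, fun x hx p u => ?_, ?_⟩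
      · exact hasDerivAlong_iterDirDeriv (by rw [hdom]; exact hΩ) (by rw [hdom]; exact hx)
      · exact (ih (l + 1)).comp_param
          (σ := fun q : (Fin l → E) × E => (Fin.snoc q.1 q.2 : Fin (l + 1) → E))
          (Continuous.finSnoc continuous_fst continuous_snd)
  exact ContParamDerivOn.contVarOn hΩ
    ((main k 0).comp_param (σ := fun _ : PUnit.{u + 1} => Fin.elim0) continuous_const)

/-! ### From `ContVarOn` to C^∞_Π -/

section IteratedVariation

variable {𝕜 : Type w} [RCLike 𝕜]
variable {E : Type u} [AddCommGroup E] [Module 𝕜 E]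
variable {F : Type v} [AddCommGroup F] [Module 𝕜 F] [TopologicalSpace F]

theorem dirDeriv_eq_of_slice {a : E →. F} {b : E × E →. F} {u : E} (h : ∀ x, a x = b (x, u))
    (v x : E) : dirDeriv 𝕜 v a x = dirDeriv 𝕜 (v, 0) b (x, u) := by
  have hdom : ∀ x, x ∈ a.Dom ↔ (x, u) ∈ b.Dom := fun x => by
    change (a x).Dom ↔ (b (x, u)).Dom
    rw [h]
  have hval : ∀ x, value a x = value b (x, u) := fun x => by
    by_cases hx : x ∈ a.Dom
    · refine value_eq_of_mem ?_
      rw [h]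
      exact mem_of_dom ((hdom x).1 hx)
    · rw [value, value, dif_neg hx, dif_neg (fun h' => hx ((hdom x).2 h'))]
  have key : HasDirDeriv 𝕜 a v x = HasDirDeriv 𝕜 b (v, 0) (x, u) := by
    funext y
    simp [HasDirDeriv, hdom, hval]
  have hpart : ∀ P Q : F → Prop, P = Q →
      (⟨∃ y, P y, fun h => h.choose⟩ : Part F) = ⟨∃ y, Q y, fun h => h.choose⟩ := by
    rintro P _ rfl
    rfl
  exact hpart _ _ key

/-- The definition peels off the last direction, `ContVarOn` the first. Directions (y j, 0) keep u
frozen, which reconciles the two recursions. -/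
theorem iterDirDeriv_cons (f : E →. F) {l : ℕ} (u : E) (y : Fin l → E) (x : E) :
    iterDirDeriv 𝕜 f (l + 1) (Fin.cons u y : Fin (l + 1) → E) x =
      iterDirDeriv 𝕜 (firstVariation 𝕜 f) l (fun j => (y j, (0 : E))) (x, u) := by
  induction l generalizing x with
  | zero => rfl
  | succ l ih =>
    have h1 : Fin.init (Fin.cons u y : Fin (l + 2) → E) =
        (Fin.cons u (Fin.init y) : Fin (l + 1) → E) := by
      funext i
      cases i using Fin.cases <;> rfl
    have h2 : (Fin.cons u y : Fin (l + 2) → E) (Fin.last (l + 1)) = y (Fin.last l) := rfl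
    rw [iterDirDeriv, h1, h2]
    exact dirDeriv_eq_of_slice (fun x => ih (Fin.init y) x) _ _

variable [TopologicalSpace E] [IsTopologicalAddGroup E] [ContinuousSMul 𝕜 E] [T2Space F]

theorem ContVarOn.iterDirDeriv {l : ℕ} {f : E →. F} (h : ContVarOn 𝕜 l f.Dom (value f)) :
    (∀ u, (iterDirDeriv 𝕜 f l u).Dom = f.Dom) ∧
      ContinuousOn (fun z : E × (Fin l → E) => value (iterDirDeriv 𝕜 f l z.2) z.1)
        (f.Dom ×ˢ univ) := by
  induction l generalizing E with
  | zero => exact ⟨fun _ => rfl, h.2.comp continuousOn_fst fun z hz => hz.1⟩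
  | succ l ih =>
    obtain ⟨h1, h2, φ', h3, h4⟩ := h
    have hmem : ∀ x ∈ f.Dom, ∀ u, φ' (x, u) ∈ firstVariation 𝕜 f (x, u) := by
      intro x hx u
      have h5 : HasDirDeriv 𝕜 f u x (φ' (x, u)) := (hasDirDeriv_iff h1).2 ⟨hx, h3 x hx u⟩
      have h6 : ∃ y, HasDirDeriv 𝕜 f u x y := ⟨_, h5⟩
      refine ⟨h6, ?_⟩
      exact (((hasDirDeriv_iff h1).1 h6.choose_spec).2).unique (h3 x hx u)
    have hdom : (firstVariation 𝕜 f).Dom = f.Dom ×ˢ univ := by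
      ext ⟨x, u⟩
      refine ⟨fun hx => ?_, fun hx => mem_dom_of_mem (hmem x hx.1 u)⟩
      obtain ⟨y, hy⟩ := hx
      exact ⟨hy.1, trivial⟩
    have h5 : ContVarOn 𝕜 l (firstVariation 𝕜 f).Dom (value (firstVariation 𝕜 f)) := by
      rw [hdom]
      exact h4.congr fun z hz => (value_eq_of_mem (hmem z.1 hz.1 z.2)).symm
    obtain ⟨hd, hc⟩ := ih h5
    have hcons : ∀ (w : Fin (l + 1) → E) (x : E), Keller.iterDirDeriv 𝕜 f (l + 1) w x =
        Keller.iterDirDeriv 𝕜 (firstVariation 𝕜 f) l (fun j => (w j.succ, (0 : E))) (x, w 0) := by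
      intro w x
      rw [← Fin.cons_self_tail w, iterDirDeriv_cons]
      rfl
    have hd' : ∀ w : Fin (l + 1) → E, (Keller.iterDirDeriv 𝕜 f (l + 1) w).Dom = f.Dom := by
      intro w
      ext x
      change (Keller.iterDirDeriv 𝕜 f (l + 1) w x).Dom ↔ _
      rw [hcons]
      change (x, w 0) ∈ (Keller.iterDirDeriv 𝕜 (firstVariation 𝕜 f) l _).Dom ↔ _
      rw [hd, hdom]
      simp
    refine ⟨hd', ?_⟩
    have h6 : Continuous fun z : E × (Fin (l + 1) → E) =>
        ((z.1, z.2 0), fun j : Fin l => (z.2 j.succ, (0 : E))) := by fun_prop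
    refine (hc.comp h6.continuousOn fun z hz => ⟨?_, trivial⟩).congr fun z hz => ?_
    · rw [hdom]
      exact ⟨hz.1, trivial⟩
    · refine value_eq_of_mem ?_
      rw [hcons]
      exact mem_of_dom (by rw [hd, hdom]; exact ⟨hz.1, trivial⟩)

theorem ContVarOn.hasDerivAlong_iterDirDeriv {f : E →. F}
    (h : ∀ k, ContVarOn 𝕜 k f.Dom (value f)) {l : ℕ} (u : Fin l → E) (v : E) {x : E}
    (hx : x ∈ f.Dom) :
    HasDerivAlong 𝕜 (value (Keller.iterDirDeriv 𝕜 f l u)) v x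
      (value (Keller.iterDirDeriv 𝕜 f (l + 1) (Fin.snoc u v : Fin (l + 1) → E)) x) :=
  Keller.hasDerivAlong_iterDirDeriv (by rw [(h l).iterDirDeriv.1]; exact (h 0).isOpen)
    (by rw [(h (l + 1)).iterDirDeriv.1]; exact hx)

variable [IsTopologicalAddGroup F] [ContinuousSMul 𝕜 F] [PolynormableSpace 𝕜 F]

/-- In the last slot this is linearity of a first variation; in an earlier slot, the inductive
identity is differentiated along the last direction. -/
theorem ContVarOn.iterDirDeriv_update {f : E →. F} (h : ∀ k, ContVarOn 𝕜 k f.Dom (value f)) {l : ℕ}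
    (u : Fin l → E) (i : Fin l) (a b : E) (c : 𝕜) {x : E} (hx : x ∈ f.Dom) :
    value (Keller.iterDirDeriv 𝕜 f l (Function.update u i (a + b))) x =
        value (Keller.iterDirDeriv 𝕜 f l (Function.update u i a)) x +
          value (Keller.iterDirDeriv 𝕜 f l (Function.update u i b)) x ∧
      value (Keller.iterDirDeriv 𝕜 f l (Function.update u i (c • a))) x =
        c • value (Keller.iterDirDeriv 𝕜 f l (Function.update u i a)) x := by
  have hΩ := (h 0).isOpen
  induction l generalizing x with
  | zero => exact i.elim0
  | succ l ih =>
    obtain ⟨u, v, rfl⟩ : ∃ (u' : Fin l → E) (v : E), (Fin.snoc u' v : Fin (l + 1) → E) = u :=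
      ⟨Fin.init u, u (Fin.last l), Fin.snoc_init_self u⟩
    have hD : ∀ (u : Fin l → E) (v : E) (x : E), x ∈ f.Dom → _ :=
      fun u v x hx => hasDerivAlong_iterDirDeriv h u v hx
    cases i using Fin.lastCases with
    | last =>
      simp only [Fin.update_snoc_last]
      have h1 : ∀ x ∈ f.Dom, ∀ v, HasDerivAlong 𝕜 (value (Keller.iterDirDeriv 𝕜 f l u)) v x
        ((fun z : E × E => value (Keller.iterDirDeriv 𝕜 f (l + 1)
          (Fin.snoc u z.2 : Fin (l + 1) → E)) z.1) (x, v)) := fun x hx v => hD u v x hx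
      have hsnoc : Continuous fun z : E × E => (Fin.snoc u z.2 : Fin (l + 1) → E) :=
        Continuous.finSnoc continuous_const continuous_snd
      have h2 : ContinuousOn (fun z : E × E => value (Keller.iterDirDeriv 𝕜 f (l + 1)
          (Fin.snoc u z.2 : Fin (l + 1) → E)) z.1) (f.Dom ×ˢ univ) :=
        (h (l + 1)).iterDirDeriv.2.comp
          (f := fun z : E × E => (z.1, (Fin.snoc u z.2 : Fin (l + 1) → E)))
          (continuous_fst.prodMk hsnoc).continuousOn
          fun z hz => ⟨hz.1, trivial⟩
      exact ⟨map_add_direction hΩ h1 h2 hx a b, map_smul_direction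
        (φ' := fun z : E × E => value (Keller.iterDirDeriv 𝕜 f (l + 1)
          (Fin.snoc u z.2 : Fin (l + 1) → E)) z.1) h1 hx c a⟩
    | cast j =>
      simp only [← Fin.snoc_update]
      refine ⟨(hD _ v x hx).unique ?_, (hD _ v x hx).unique ?_⟩
      · exact ((hD _ v x hx).add (hD _ v x hx)).congr_of_eqOn hΩ hx
          fun y hy => (ih u j hy).1.symm
      · exact ((hD _ v x hx).const_smul c).congr_of_eqOn hΩ hx fun y hy => (ih u j hy).2.symm

/-- The value at `x` of the `l`th differential of an infinitely differentiable map. -/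
noncomputable def ContVarOn.multilinear {f : E →. F} (h : ∀ k, ContVarOn 𝕜 k f.Dom (value f))
    (l : ℕ) {x : E} (hx : x ∈ f.Dom) : MultilinearMap 𝕜 (fun _ : Fin l => E) F where
  toFun u := value (Keller.iterDirDeriv 𝕜 f l u) x
  map_update_add' u i a b := by
    convert (iterDirDeriv_update h u i a b 0 hx).1
  map_update_smul' u i c a := by
    convert (iterDirDeriv_update h u i a 0 c hx).2

theorem ContVarOn.multilinear_mem {f : E →. F} (h : ∀ k, ContVarOn 𝕜 k f.Dom (value f))
    (l : ℕ) {x : E} (hx : x ∈ f.Dom) : multilinear h l hx ∈ differential 𝕜 l f x :=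
  mem_differential_of_forall_mem fun u => mem_of_dom (by rw [(h l).iterDirDeriv.1]; exact hx)

theorem ContVarOn.isCPi {f : E →. F} (h : ∀ k, ContVarOn 𝕜 k f.Dom (value f)) : IsCPi 𝕜 ⊤ f := by
  have hΩ : IsOpen f.Dom := (h 0).isOpen
  refine ⟨hΩ, fun l _ => ⟨?_, ?_, ?_⟩⟩
  · refine Subset.antisymm (fun x hx => ?_) fun x hx => mem_dom_of_mem (multilinear_mem h l hx)
    exact iterDirDeriv_dom_subset f l 0 (differential_dom_subset hx 0)
  · intro x M hM
    have hx : x ∈ f.Dom := iterDirDeriv_dom_subset f l 0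
      (mem_dom_of_mem (mem_iterDirDeriv_of_mem_differential hM 0))
    rw [Part.mem_unique hM (multilinear_mem h l hx), ← continuousOn_univ]
    exact (h l).iterDirDeriv.2.comp (f := fun u => (x, u)) (by fun_prop) fun u _ => ⟨hx, trivial⟩
  · intro x hx W hW
    obtain ⟨s, r, hr, hsW⟩ := ((PolynormableSpace.withSeminorms 𝕜 F).mem_nhds_iff 0 W).1 hW
    set p : Seminorm 𝕜 F := s.sup fun p : {p : Seminorm 𝕜 F // Continuous p} => p.1 with hp_def
    have hp : Continuous p := by
      have h1 : (p : F → ℝ) = fun x => ((s.sup fun q => ⟨q.1 x, apply_nonneg q.1 x⟩ : NNReal) : ℝ) :=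
        funext fun x => Seminorm.finset_sup_apply _ _ _
      rw [h1]
      exact NNReal.continuous_coe.comp
        (Continuous.finset_sup_apply fun q _ => q.2.subtype_mk _)
    -- There is at least one slot, so multilinearity forces 0, even for l = 0.
    have hzero : value (Keller.iterDirDeriv 𝕜 f (l + 1) 0) x = 0 :=
      (multilinear h (l + 1) hx).map_zero
    have hnhds : {z : E × (Fin (l + 1) → E) | z.1 ∈ f.Dom ∧
        p (value (Keller.iterDirDeriv 𝕜 f (l + 1) z.2) z.1) < r} ∈ 𝓝 (x, (0 : Fin (l + 1) → E)) := by
      have hopen : IsOpen (f.Dom ×ˢ (univ : Set (Fin (l + 1) → E))) := hΩ.prod isOpen_univ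
      have h1 : f.Dom ×ˢ (univ : Set (Fin (l + 1) → E)) ∈ 𝓝 (x, (0 : Fin (l + 1) → E)) :=
        hopen.mem_nhds ⟨hx, trivial⟩
      have h2 := hp.continuousAt.comp ((h (l + 1)).iterDirDeriv.2.continuousAt h1)
      have h3 := h2.eventually_lt (continuousAt_const (y := r)) (by simpa [hzero] using hr)
      filter_upwards [h1, h3] with z hz1 hz2 using ⟨hz1.1, hz2⟩
    rw [nhds_prod_eq, mem_prod_iff] at hnhds
    obtain ⟨A, hA, B, hB, hAB⟩ := hnhds
    rw [nhds_pi, Filter.mem_pi] at hB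
    obtain ⟨I, -, t, ht, htB⟩ := hB
    have hU : (⋂ i, t i) ∈ 𝓝 (0 : E) := by
      rw [iInter_mem]
      exact ht
    refine ⟨⋂ i, t i, hU, fun ε hε => ?_⟩
    have hε' : (ε : 𝕜) ≠ 0 := by exact_mod_cast hε.ne'
    have hA' : (fun v => x + v) ⁻¹' A ∈ 𝓝 (0 : E) := by
      have hc : Continuous fun v : E => x + v := by fun_prop
      exact hc.continuousAt.preimage_mem_nhds (by simpa using hA)
    -- The balanced core keeps the whole segment from x to x + v in A. The second set gives v = ε •
    -- v' with v' in U, and ε then comes out of the last slot of d^{l+1} f.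
    refine ⟨balancedCore 𝕜 ((fun v => x + v) ⁻¹' A) ∩ (ε : 𝕜) • ⋂ i, t i,
      inter_mem (balancedCore_mem_nhds_zero hA') ((set_smul_mem_nhds_zero_iff hε').2 hU), ?_⟩
    rintro v ⟨hv, v', hv', rfl⟩
    simp only at hv ⊢
    have hB0 : ∀ w : Fin (l + 1) → E, (∀ i, w i ∈ ⋂ i, t i) → w ∈ B :=
      fun w hw => htB fun i _ => mem_iInter.1 (hw i) i
    have hseg : ∀ c ∈ Icc (0 : ℝ) 1, x + (c : 𝕜) • (ε : 𝕜) • v' ∈ A := by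
      intro c hc
      refine balancedCore_subset ((fun v => x + v) ⁻¹' A) ((balancedCore_balanced _).smul_mem ?_ hv)
      rw [RCLike.norm_ofReal, abs_of_nonneg hc.1]
      exact hc.2
    have h0B : (0 : Fin (l + 1) → E) ∈ B := hB0 0 fun i => mem_of_mem_nhds hU
    have hdom : ∀ c ∈ Icc (0 : ℝ) 1, x + (c : 𝕜) • (ε : 𝕜) • v' ∈ f.Dom :=
      fun c hc => (hAB (mk_mem_prod (hseg c hc) h0B)).1
    have hxv : x + (ε : 𝕜) • v' ∈ f.Dom := by simpa using hdom 1 (by simp)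
    refine ⟨_, multilinear_mem h l hxv, _, multilinear_mem h l hx, fun u hu => ?_⟩
    obtain ⟨c, hc, hle⟩ := exists_seminorm_segment_le p hp (fun c hc =>
      hasDerivAlong_iterDirDeriv h u ((ε : 𝕜) • v') (hdom c hc)) 0
    have hc' := Ioo_subset_Icc_self hc
    have hsmul := map_smul_direction (fun x hx v => hasDerivAlong_iterDirDeriv h u v hx)
      (φ' := fun z : E × E => value (Keller.iterDirDeriv 𝕜 f (l + 1)
        (Fin.snoc u z.2 : Fin (l + 1) → E)) z.1) (hdom c hc') (ε : 𝕜) v'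
    have hlt := (hAB (mk_mem_prod (hseg c hc') (hB0 (Fin.snoc u v') fun i => ?_))).2
    · simp only [sub_zero] at hle hsmul
      rw [hsmul, map_smul_eq_mul, RCLike.norm_ofReal, abs_of_pos hε] at hle
      refine (mem_smul_set_iff_inv_smul_mem₀ hε' _ _).2 (hsW ?_)
      rw [Seminorm.mem_ball_zero, map_smul_eq_mul, norm_inv, RCLike.norm_ofReal, abs_of_pos hε,
        inv_mul_lt_iff₀ hε]
      exact hle.trans_lt (mul_lt_mul_of_pos_left hlt hε)
    · cases i using Fin.lastCases with
      | last => simpa using hv'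
      | cast j => simpa using hu j

end IteratedVariation

end Keller

/-! ### The main theorem -/

theorem theorem3p5 {𝕜 : Type w} [RCLike 𝕜]
    (𝒞 : ∀ (E : Keller.LCS.{w, u} 𝕜) (F : Keller.LCS.{w, v} 𝕜), Set (E →. F))
    (h_cont : ∀ (E : Keller.LCS.{w, u} 𝕜) (F : Keller.LCS.{w, v} 𝕜), ∀ f ∈ 𝒞 E F,
      Keller.IsCPi 𝕜 0 f)
    (h_diff : ∀ (E : Keller.LCS.{w, u} 𝕜) (F : Keller.LCS.{w, v} 𝕜), ∀ f ∈ 𝒞 E F,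
      Keller.AlmostGateauxDifferentiable 𝕜 f)
    (h_var : ∀ (E : Keller.LCS.{w, u} 𝕜) (F : Keller.LCS.{w, v} 𝕜), ∀ f ∈ 𝒞 E F,
      ∃ (G : Keller.LCS.{w, u} 𝕜), ∃ g ∈ 𝒞 G F, ∃ h : (E × E) →. G,
        Keller.IsCc 𝕜 ⊤ h ∧ Keller.firstVariation 𝕜 f = g.comp h) :
    ∀ (E : Keller.LCS.{w, u} 𝕜) (F : Keller.LCS.{w, v} 𝕜), ∀ f ∈ 𝒞 E F, Keller.IsCPi 𝕜 ⊤ f := by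
  -- The spaces and f are quantified inside the induction on k, since the hypothesis is applied to
  -- g, which lives on another space G.
  have main : ∀ (k : ℕ) (E : Keller.LCS.{w, u} 𝕜) (F : Keller.LCS.{w, v} 𝕜), ∀ f ∈ 𝒞 E F,
      Keller.ContVarOn 𝕜 k f.Dom (Keller.value f) := by
    intro k
    induction k with
    | zero => exact fun E F f hf => ⟨(h_cont E F f hf).1, (h_cont E F f hf).continuousOn⟩
    | succ k ih =>
      intro E F f hf
      have hΩ := (h_cont E F f hf).1
      obtain ⟨G, g, hg, h, hh, hfg⟩ := h_var E F f hf
      have hdom : (Keller.firstVariation 𝕜 f).Dom = f.Dom ×ˢ Set.univ := h_diff E F f hf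
      have hval : ∀ z ∈ (Keller.firstVariation 𝕜 f).Dom, z ∈ h.Dom ∧
          Keller.value h z ∈ g.Dom ∧
          Keller.value g (Keller.value h z) ∈ Keller.firstVariation 𝕜 f z := by
        intro z hz
        have hz' := Keller.mem_of_dom hz
        rw [hfg] at hz' ⊢
        obtain ⟨y, hy, hy'⟩ := Part.mem_bind_iff.1 hz'
        rw [Keller.value_eq_of_mem hy]
        refine ⟨Keller.mem_dom_of_mem hy, Keller.mem_dom_of_mem hy', ?_⟩
        exact Part.mem_bind_iff.2 ⟨y, hy, Keller.mem_of_dom (Keller.mem_dom_of_mem hy')⟩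
      have hset : h.Dom ∩ Keller.value h ⁻¹' g.Dom = f.Dom ×ˢ Set.univ := by
        rw [← hdom]
        refine Set.Subset.antisymm (fun z hz => ?_) fun z hz => ⟨(hval z hz).1, (hval z hz).2.1⟩
        rw [hfg]
        exact Keller.mem_dom_of_mem
          (Part.mem_bind_iff.2 ⟨_, Keller.mem_of_dom hz.1, Keller.mem_of_dom hz.2⟩)
      refine ⟨hΩ, (h_cont E F f hf).continuousOn, fun z => Keller.value g (Keller.value h z),
        fun x hx u => ?_, ?_⟩
      · obtain ⟨hd, hy⟩ := (hval (x, u) (by rw [hdom]; exact ⟨hx, trivial⟩)).2.2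
        change Keller.HasDerivAlong 𝕜 _ u x (Keller.value g (Keller.value h (x, u)))
        rw [← hy]
        exact ((Keller.hasDirDeriv_iff hΩ).1 hd.choose_spec).2
      · rw [← hset]
        exact (ih G F g hg).comp (hh.contVarOn k)
  exact fun E F f hf => Keller.ContVarOn.isCPi fun k => main k E F f hf
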